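/- Let $k \geq 1$ be an integer and let $M$ be a positive real number. Then there exists an integer $d$ such that $d+i > 0$ for all $i = 1, \ldots, k$, the fields $\mathbb{Q}(\sqrt{d+1}), \ldots, \mathbb{Q}(\sqrt{d+k})$ are $k$ pairwise distinct real quadratic fields (each of degree $2$ over $\mathbb{Q}$), and $h(d+i) > M$ for all $i = 1, \ldots, k$, where $h(m)$ denotes the class number of the field $\mathbb{Q}(\sqrt{m})$, that is, the order of the ideal class group of its ring of integers. -/

import Mathlib

/-- The field `ℚ(√m)`, as a subfield of `ℝ`. It is meant for `m ≥ 0`, where `Real.sqrt m` is the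
genuine square root. -/
noncomputable def realQuadField (m : ℤ) : IntermediateField ℚ ℝ :=
  IntermediateField.adjoin ℚ {Real.sqrt (m : ℝ)}

theorem isIntegral_real_sqrt_intCast (m : ℤ) : IsIntegral ℚ (Real.sqrt (m : ℝ)) := by
  refine IsIntegral.of_pow (n := 2) two_pos ?_
  rcases le_total (m : ℝ) 0 with h | h
  · rw [Real.sqrt_eq_zero_of_nonpos h]
    simpa using isIntegral_zero
  · rw [Real.sq_sqrt h]
    simpa using isIntegral_algebraMap (R := ℚ) (A := ℝ) (x := (m : ℚ))

instance realQuadField_numberField (m : ℤ) : NumberField (realQuadField m) where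
  to_charZero := inferInstance
  to_finiteDimensional :=
    IntermediateField.adjoin.finiteDimensional (isIntegral_real_sqrt_intCast m)

/-- `h(m)`, the class number of `ℚ(√m)`. -/
noncomputable def realQuadClassNumber (m : ℤ) : ℕ :=
  NumberField.classNumber (realQuadField m)

/-!
Let `a` be squarefree, prime to `b`, with `b` not a square. In `K = ℚ(√(ab))` every divisor `n` of
`a` gives an ideal `(n, √(ab))` with square `(n)`. If two such ideals lie in the same class, the
corresponding divisors agree modulo squares of `K` up to a unit, while distinct divisors of `a`
remain distinct modulo squares of `K`. Units modulo squares form a group of order at most `4`, so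
`2 ^ ω(a) ≤ 4 h(K)`. By the Chinese remainder theorem each of `d + 1, …, d + k` can be made to have
such a factor `a` with as many primes as desired, all of them larger than `k`; as these primes
divide only one of the `k` numbers, the fields are distinct.
-/

open IntermediateField NumberField

section Squares

theorem isSquare_left_of_coprime_of_isSquare_mul {a b : ℕ} (hab : a.Coprime b)
    (h : IsSquare (a * b)) : IsSquare a := by
  obtain ⟨r, hr⟩ := isSquare_iff_exists_sq _ |>.1 h
  obtain ⟨d, hd⟩ := exists_eq_pow_of_mul_eq_pow (Nat.isUnit_iff.2 hab) hr
  exact hd ▸ IsSquare.sq d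

theorem not_isSquare_mul_of_squarefree_of_coprime {a b : ℕ} (ha : Squarefree a) (ha1 : a ≠ 1)
    (hab : a.Coprime b) : ¬ IsSquare (a * b) := by
  intro h
  obtain ⟨r, rfl⟩ := isSquare_left_of_coprime_of_isSquare_mul hab h
  exact ha1 (by rw [Nat.isUnit_iff.1 (ha r dvd_rfl)])

theorem eq_of_isSquare_mul_of_squarefree {a b : ℕ} (ha : Squarefree a) (hb : Squarefree b)
    (h : IsSquare (a * b)) : a = b := by
  obtain ⟨r, hr⟩ := h
  obtain ⟨t, rfl⟩ : a ∣ r :=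
    (ha.dvd_pow_iff_dvd two_ne_zero).1 ⟨b, by rw [sq, hr]⟩
  have hb' : b = a * (t * t) := by
    refine Nat.eq_of_mul_eq_mul_left (Nat.pos_of_ne_zero ha.ne_zero) ?_
    rw [hr]
    ring
  have ht : t = 1 := Nat.isUnit_iff.1 (hb t ⟨a, by rw [hb', mul_comm]⟩)
  rw [hb', ht, mul_one, mul_one]

theorem card_divisors_of_squarefree {n : ℕ} (hn : Squarefree n) :
    n.divisors.card = 2 ^ n.primeFactors.card := by
  rw [Nat.card_divisors hn.ne_zero]
  refine Finset.prod_eq_pow_card fun p hp => ?_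
  rw [Nat.factorization_eq_one_of_squarefree hn (Nat.prime_of_mem_primeFactors hp)
    (Nat.dvd_of_mem_primeFactors hp)]

theorem isSquare_of_isSquare_sq_mul {R : Type*} [CommRing R] [IsDomain R] [IsIntegrallyClosed R]
    {a y : R} (hy : y ≠ 0) (h : IsSquare (y ^ 2 * a)) : IsSquare a := by
  obtain ⟨z, hz⟩ := isSquare_iff_exists_sq _ |>.1 h
  obtain ⟨t, rfl⟩ : y ∣ z := (IsIntegrallyClosed.pow_dvd_pow_iff two_ne_zero).1 ⟨a, hz.symm⟩
  rw [mul_pow] at hz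
  exact ⟨t, by rw [mul_left_cancel₀ (pow_ne_zero 2 hy) hz, sq]⟩

theorem isSquare_mul_of_sq_mul_eq {R : Type*} [CommRing R] [IsDomain R] [IsIntegrallyClosed R]
    {a b b' x x' y y' u w : R} (hy : y ≠ 0) (hy' : y' ≠ 0) (h : x ^ 2 * a * u = y ^ 2 * b)
    (h' : x' ^ 2 * a * (u * w ^ 2) = y' ^ 2 * b') : IsSquare (b * b') := by
  refine isSquare_of_isSquare_sq_mul (mul_ne_zero hy hy') ⟨x * x' * a * u * w, ?_⟩
  linear_combination -(y' ^ 2 * b') * h - x ^ 2 * a * u * h'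

end Squares

section SquareClasses

theorem index_range_powMonoidHom_dvd (G : Type*) [CommGroup G] [Group.FG G] (n : ℕ) :
    (powMonoidHom n : G →* G).range.index ∣ n ^ Group.rank G := by
  have hexp : ∀ x : G ⧸ (powMonoidHom n : G →* G).range, x ^ n = 1 := by
    rintro ⟨g⟩
    exact (QuotientGroup.eq_one_iff _).2 ⟨g, rfl⟩
  exact (card_dvd_exponent_pow_rank' _ hexp).trans <| pow_dvd_pow n <|
    Group.rank_le_of_surjective _ (QuotientGroup.mk'_surjective _)

theorem span_pair_sq_eq_span_singleton {R : Type*} [CommRing R] {a b s : R} (hab : IsCoprime a b)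
    (hs : s ^ 2 = a * b) : Ideal.span {a, s} ^ 2 = Ideal.span {a} := by
  obtain ⟨u, v, huv⟩ := hab
  rw [sq, Ideal.span_pair_mul_span_pair, ← sq s, hs]
  apply le_antisymm
  · rw [Ideal.span_le]
    rintro x (rfl | rfl | rfl | rfl) <;>
      simp only [SetLike.mem_coe, Ideal.mem_span_singleton, dvd_mul_right, dvd_mul_left]
  · have ha_eq : u * (a * a) + v * (a * b) = a := by linear_combination a * huv
    have hmem : u * (a * a) + v * (a * b) ∈ Ideal.span {a * a, a * s, s * a, a * b} :=
      Ideal.add_mem _ (Ideal.mul_mem_left _ _ (Ideal.subset_span (by simp)))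
        (Ideal.mul_mem_left _ _ (Ideal.subset_span (by simp)))
    rwa [ha_eq, ← Ideal.span_singleton_le_iff_mem] at hmem

variable {R : Type*} [CommRing R] [IsDedekindDomain R]

theorem exists_unit_of_mk0_eq_mk0 {I J : nonZeroDivisors (Ideal R)} {a b : R}
    (hI : (I : Ideal R) ^ 2 = Ideal.span {a}) (hJ : (J : Ideal R) ^ 2 = Ideal.span {b})
    (h : ClassGroup.mk0 I = ClassGroup.mk0 J) :
    ∃ x y : R, y ≠ 0 ∧ ∃ u : Rˣ, x ^ 2 * a * u = y ^ 2 * b := by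
  obtain ⟨x, y, -, hy, hxy⟩ := ClassGroup.mk0_eq_mk0_iff.1 h
  refine ⟨x, y, hy, Ideal.span_singleton_eq_span_singleton.1 ?_⟩
  simp only [← Ideal.span_singleton_mul_span_singleton, ← Ideal.span_singleton_pow, ← hI, ← hJ,
    ← mul_pow, hxy]

/-- Sending `i` to the class of `I i` and to the square class of the unit comparing `a i` with
a chosen `a j` of the same ideal class is injective. -/
theorem card_le_index_mul_card_classGroup {ι : Type*} [Finite (ClassGroup R)]
    [(powMonoidHom 2 : Rˣ →* Rˣ).range.FiniteIndex] {a : ι → R} {I : ι → Ideal R}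
    (ha0 : ∀ i, a i ≠ 0) (hI : ∀ i, I i ^ 2 = Ideal.span {a i})
    (ha : ∀ i j, IsSquare (a i * a j) → i = j) :
    Nat.card ι ≤ (powMonoidHom 2 : Rˣ →* Rˣ).range.index * Nat.card (ClassGroup R) := by
  have hI0 : ∀ i, I i ∈ nonZeroDivisors (Ideal R) := fun i =>
    mem_nonZeroDivisors_of_ne_zero fun h => ha0 i <| by
      rw [← Ideal.span_singleton_eq_bot, ← hI, h, zero_pow two_ne_zero, Ideal.zero_eq_bot]
  let cl : ι → ClassGroup R := fun i => ClassGroup.mk0 ⟨I i, hI0 i⟩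
  let rep : ι → ι := fun i => Set.rangeSplitting cl ⟨cl i, i, rfl⟩
  have hrep : ∀ i, cl (rep i) = cl i := fun i => Set.apply_rangeSplitting cl _
  have hcompare : ∀ i, ∃ x y : R, y ≠ 0 ∧ ∃ u : Rˣ, x ^ 2 * a (rep i) * u = y ^ 2 * a i :=
    fun i => exists_unit_of_mk0_eq_mk0 (I := ⟨_, hI0 (rep i)⟩) (J := ⟨_, hI0 i⟩) (hI _) (hI i)
      (hrep i)
  choose x y hy u hu using hcompare
  have hinj : Function.Injective fun i =>
      ((u i : Rˣ ⧸ (powMonoidHom 2 : Rˣ →* Rˣ).range), cl i) := by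
    intro i j hij
    obtain ⟨huij, hcl⟩ := Prod.mk.inj hij
    obtain ⟨w, hw⟩ := QuotientGroup.eq.1 huij
    have hw' : (u j : R) = u i * w ^ 2 := by
      rw [← Units.val_pow_eq_pow_val, ← Units.val_mul]
      exact congrArg Units.val (eq_mul_of_inv_mul_eq hw.symm)
    have hrij : rep j = rep i := by simp only [rep, hcl]
    exact ha i j (isSquare_mul_of_sq_mul_eq (hy i) (hy j) (hu i) (hw' ▸ hrij ▸ hu j))
  exact (Nat.card_le_card_of_injective _ hinj).trans_eq (Nat.card_prod _ _)

end SquareClasses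

section NumberField

variable (K : Type*) [Field K] [NumberField K]

instance group_fg_units : Group.FG (𝓞 K)ˣ := Group.fg_iff_monoid_fg.2 inferInstance

theorem group_rank_units_le : Group.rank (𝓞 K)ˣ ≤ Units.rank K + 1 := by
  classical
  obtain ⟨ζ, hζ⟩ := Subgroup.isCyclic_iff_exists_zpowers_eq_top _ |>.1
    (inferInstance : IsCyclic (Units.torsion K))
  let S : Finset (𝓞 K)ˣ := insert ζ (Finset.univ.image (Units.fundSystem K))
  have hS : Subgroup.closure (S : Set (𝓞 K)ˣ) = ⊤ := by
    rw [← Units.closure_fundSystem_sup_torsion_eq_top K, ← hζ, Subgroup.zpowers_eq_closure,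
      ← Subgroup.closure_union, Set.union_singleton]
    simp [S]
  calc Group.rank (𝓞 K)ˣ ≤ S.card := Group.rank_le hS
    _ ≤ (Finset.univ.image (Units.fundSystem K)).card + 1 := Finset.card_insert_le _ _
    _ ≤ Units.rank K + 1 := by
      gcongr
      simpa using Finset.card_image_le (s := Finset.univ) (f := Units.fundSystem K)

theorem units_rank_lt_finrank : Units.rank K < Module.finrank ℚ K := by
  have hplaces := InfinitePlace.card_eq_nrRealPlaces_add_nrComplexPlaces K
  have hdegree := InfinitePlace.card_add_two_mul_card_eq_rank K
  have hpos : 0 < Module.finrank ℚ K := Module.finrank_pos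
  unfold Units.rank
  omega

theorem card_le_two_pow_finrank_mul_classNumber {ι : Type*} {a : ι → 𝓞 K} {I : ι → Ideal (𝓞 K)}
    (ha0 : ∀ i, a i ≠ 0) (hI : ∀ i, I i ^ 2 = Ideal.span {a i})
    (ha : ∀ i j, IsSquare (a i * a j) → i = j) :
    Nat.card ι ≤ 2 ^ Module.finrank ℚ K * classNumber K := by
  have hindex : (powMonoidHom 2 : (𝓞 K)ˣ →* (𝓞 K)ˣ).range.index ∣ 2 ^ Module.finrank ℚ K :=
    (index_range_powMonoidHom_dvd _ 2).trans <| pow_dvd_pow 2 <|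
      (group_rank_units_le K).trans (units_rank_lt_finrank K)
  have : (powMonoidHom 2 : (𝓞 K)ˣ →* (𝓞 K)ˣ).range.FiniteIndex :=
    ⟨ne_zero_of_dvd_ne_zero (by positivity) hindex⟩
  calc Nat.card ι ≤ _ := card_le_index_mul_card_classGroup ha0 hI ha
    _ ≤ 2 ^ Module.finrank ℚ K * classNumber K := by
      rw [classNumber, Nat.card_eq_fintype_card]
      gcongr
      exact Nat.le_of_dvd (by positivity) hindex

theorem two_pow_card_primeFactors_le_two_pow_finrank_mul_classNumber {s : 𝓞 K} {a b : ℕ}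
    (ha : Squarefree a) (hab : a.Coprime b) (hs : s ^ 2 = (a * b : ℕ))
    (hclass : ∀ n n' : ℕ, n ∣ a → n' ∣ a → IsSquare ((n * n' : ℕ) : 𝓞 K) → n = n') :
    2 ^ a.primeFactors.card ≤ 2 ^ Module.finrank ℚ K * classNumber K := by
  have hdvd : ∀ n : a.divisors, (n : ℕ) ∣ a := fun n => Nat.dvd_of_mem_divisors n.2
  have hne : ∀ n : a.divisors, ((n : ℕ) : 𝓞 K) ≠ 0 := fun n =>
    Nat.cast_ne_zero.2 (Nat.pos_of_mem_divisors n.2).ne'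
  have hsq : ∀ n : a.divisors,
      Ideal.span {((n : ℕ) : 𝓞 K), s} ^ 2 = Ideal.span {((n : ℕ) : 𝓞 K)} := by
    intro n
    obtain ⟨t, ht⟩ := hdvd n
    have hcop : (n : ℕ).Coprime (t * b) :=
      (Nat.coprime_of_squarefree_mul (ht ▸ ha)).mul_right (hab.coprime_dvd_left (hdvd n))
    exact span_pair_sq_eq_span_singleton hcop.cast (by
      rw [hs, ← Nat.cast_mul, ← mul_assoc, ← ht])
  calc 2 ^ a.primeFactors.card = Nat.card a.divisors := by
        rw [← card_divisors_of_squarefree ha, Nat.card_eq_fintype_card, Fintype.card_coe]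
    _ ≤ 2 ^ Module.finrank ℚ K * classNumber K :=
        card_le_two_pow_finrank_mul_classNumber K hne hsq fun n n' h =>
          Subtype.ext (hclass n n' (hdvd n) (hdvd n') (by rwa [Nat.cast_mul]))

end NumberField

section AdjoinSqrt

variable {F E : Type*} [Field F] [Field E] [Algebra F E] {α : E} {c : F}

theorem finrank_adjoin_sqrt (hα : α ^ 2 = algebraMap F E c) (hc : ¬ IsSquare c) :
    Module.finrank F F⟮α⟯ = 2 := by
  have hirr : Irreducible (Polynomial.X ^ 2 - Polynomial.C c) :=
    X_pow_sub_C_irreducible_of_prime Nat.prime_two fun b hb => hc ⟨b, by rw [← hb, sq]⟩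
  have hmin := minpoly.eq_of_irreducible_of_monic hirr (x := α) (by simp [hα])
    (Polynomial.monic_X_pow_sub_C _ two_ne_zero)
  have hint : IsIntegral F α := .of_pow two_pos (hα ▸ isIntegral_algebraMap)
  rw [adjoin.finrank hint, ← hmin, Polynomial.natDegree_X_pow_sub_C]

theorem exists_eq_add_mul_of_mem_adjoin_sqrt (hα : α ^ 2 = algebraMap F E c) {x : E}
    (hx : x ∈ F⟮α⟯) : ∃ p q : F, x = algebraMap F E p + algebraMap F E q * α := by
  have hint : IsIntegral F α := .of_pow two_pos (hα ▸ isIntegral_algebraMap)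
  rw [← mem_toSubalgebra, adjoin_simple_toSubalgebra_of_isAlgebraic hint.isAlgebraic] at hx
  induction hx using Algebra.adjoin_induction with
  | mem x hx => exact ⟨0, 1, by simpa using hx⟩
  | algebraMap r => exact ⟨r, 0, by simp⟩
  | add x y _ _ hx hy =>
    obtain ⟨p, q, rfl⟩ := hx
    obtain ⟨p', q', rfl⟩ := hy
    exact ⟨p + p', q + q', by simp only [map_add]; ring⟩
  | mul x y _ _ hx hy =>
    obtain ⟨p, q, rfl⟩ := hx
    obtain ⟨p', q', rfl⟩ := hy
    refine ⟨p * p' + q * q' * c, p * q' + p' * q, ?_⟩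
    simp only [map_add, map_mul]
    linear_combination algebraMap F E q * algebraMap F E q' * hα

theorem isSquare_or_isSquare_mul_of_sq_mem_adjoin_sqrt [NeZero (2 : F)]
    (hα : α ^ 2 = algebraMap F E c) {x : E} (hx : x ∈ F⟮α⟯) {b : F}
    (hxb : x ^ 2 = algebraMap F E b) : IsSquare b ∨ IsSquare (b * c) := by
  have hinj := (algebraMap F E).injective
  obtain ⟨p, q, hpq⟩ := exists_eq_add_mul_of_mem_adjoin_sqrt hα hx
  have htrace : algebraMap F E (2 * p) * x = algebraMap F E (b + p ^ 2 - q ^ 2 * c) := by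
    simp only [map_add, map_sub, map_mul, map_pow, map_ofNat, ← hxb, ← hα, hpq]
    ring
  obtain rfl | hp := eq_or_ne p 0
  · right
    refine ⟨q * c, hinj ?_⟩
    rw [map_mul, ← hxb, hpq]
    simp only [map_zero, zero_add, map_mul, ← hα]
    ring
  · left
    have h2p : 2 * p ≠ 0 := mul_ne_zero two_ne_zero hp
    refine ⟨(b + p ^ 2 - q ^ 2 * c) / (2 * p), hinj ?_⟩
    have hx' : algebraMap F E ((b + p ^ 2 - q ^ 2 * c) / (2 * p)) = x := by
      rw [map_div₀, ← htrace, mul_div_cancel_left₀ _ ((map_ne_zero _).2 h2p)]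
    rw [map_mul, hx', ← sq, hxb]

end AdjoinSqrt

section RealQuadratic

variable {m n : ℕ}

theorem sqrt_intCast_natCast_sq (m : ℕ) : √((m : ℤ) : ℝ) ^ 2 = algebraMap ℚ ℝ m := by
  rw [Int.cast_natCast, Real.sq_sqrt m.cast_nonneg, map_natCast]

theorem finrank_realQuadField (hm : ¬ IsSquare m) : Module.finrank ℚ (realQuadField m) = 2 :=
  finrank_adjoin_sqrt (sqrt_intCast_natCast_sq m) (by rwa [Rat.isSquare_natCast_iff])

theorem isSquare_or_isSquare_mul_of_sq_mem_realQuadField {x : ℝ} (hx : x ∈ realQuadField m)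
    (hxn : x ^ 2 = n) : IsSquare n ∨ IsSquare (n * m) := by
  simpa only [← Nat.cast_mul, Rat.isSquare_natCast_iff] using
    isSquare_or_isSquare_mul_of_sq_mem_adjoin_sqrt (sqrt_intCast_natCast_sq m) hx
      (b := n) (by rw [hxn, map_natCast])

theorem realQuadField_ne (hm : ¬ IsSquare m) (hmn : ¬ IsSquare (m * n)) :
    realQuadField m ≠ realQuadField n := by
  intro h
  have hmem : √((m : ℤ) : ℝ) ∈ realQuadField n := h ▸ mem_adjoin_simple_self ℚ _
  exact (isSquare_or_isSquare_mul_of_sq_mem_realQuadField hmem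
    (by rw [sqrt_intCast_natCast_sq, map_natCast])).elim hm hmn

theorem exists_ringOfIntegers_realQuadField_sq_eq (m : ℕ) :
    ∃ s : 𝓞 (realQuadField m), s ^ 2 = m := by
  let r : realQuadField m := AdjoinSimple.gen ℚ √((m : ℤ) : ℝ)
  have hr : r ^ 2 = m := Subtype.ext <| by
    rw [SubmonoidClass.coe_pow, AdjoinSimple.coe_gen, sqrt_intCast_natCast_sq, map_natCast]
    rfl
  have hint : IsIntegral ℤ r := .of_pow two_pos (hr ▸ isIntegral_natCast m)
  obtain ⟨s, hs⟩ := IsIntegralClosure.isIntegral_iff (A := 𝓞 (realQuadField m)) |>.1 hint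
  exact ⟨s, FaithfulSMul.algebraMap_injective _ (realQuadField m) <| by
    rw [map_pow, map_natCast, hs, hr]⟩

theorem isSquare_or_isSquare_mul_of_isSquare_ringOfIntegers
    (h : IsSquare (n : 𝓞 (realQuadField m))) : IsSquare n ∨ IsSquare (n * m) := by
  obtain ⟨x, hx⟩ := h
  refine isSquare_or_isSquare_mul_of_sq_mem_realQuadField (x : realQuadField m).2 ?_
  have hx' := congrArg (fun y : 𝓞 (realQuadField m) => ((y : realQuadField m) : ℝ)) hx
  simpa [sq] using hx'.symm

theorem two_pow_card_primeFactors_le_four_mul_realQuadClassNumber {a b : ℕ} (ha : Squarefree a)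
    (hb : ¬ IsSquare b) (hab : a.Coprime b) :
    2 ^ a.primeFactors.card ≤ 4 * realQuadClassNumber (a * b : ℕ) := by
  have hm : ¬ IsSquare (a * b) := fun h =>
    hb (isSquare_left_of_coprime_of_isSquare_mul hab.symm (mul_comm a b ▸ h))
  obtain ⟨s, hs⟩ := exists_ringOfIntegers_realQuadField_sq_eq (a * b)
  have hclass : ∀ n n' : ℕ, n ∣ a → n' ∣ a →
      IsSquare ((n * n' : ℕ) : 𝓞 (realQuadField (a * b : ℕ))) → n = n' := by
    intro n n' hn hn' h
    obtain h | h := isSquare_or_isSquare_mul_of_isSquare_ringOfIntegers h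
    · exact eq_of_isSquare_mul_of_squarefree (ha.squarefree_of_dvd hn)
        (ha.squarefree_of_dvd hn') h
    · have hcop : b.Coprime (n * n' * a) :=
        (((hab.coprime_dvd_left hn).mul_left (hab.coprime_dvd_left hn')).mul_left hab).symm
      exact absurd (isSquare_left_of_coprime_of_isSquare_mul hcop (by rwa [mul_comm b, mul_assoc]))
        hb
  have hle := two_pow_card_primeFactors_le_two_pow_finrank_mul_classNumber _ ha hab hs hclass
  rwa [finrank_realQuadField hm] at hle

/-- One prime of `a` is moved into the cofactor to make the latter a nonsquare. -/
theorem two_pow_card_primeFactors_le_eight_mul_realQuadClassNumber {a b : ℕ} (ha : Squarefree a)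
    (ha1 : a ≠ 1) (hab : a.Coprime b) :
    2 ^ a.primeFactors.card ≤ 8 * realQuadClassNumber (a * b : ℕ) := by
  obtain ⟨p, hp, t, rfl⟩ := Nat.exists_prime_and_dvd ha1
  have hpt : p.Coprime t := Nat.coprime_of_squarefree_mul ha
  have hpb : p.Coprime b := hab.coprime_mul_right
  have hle := two_pow_card_primeFactors_le_four_mul_realQuadClassNumber (a := t) (b := p * b)
    (ha.squarefree_of_dvd (dvd_mul_left _ _))
    (not_isSquare_mul_of_squarefree_of_coprime hp.prime.squarefree hp.ne_one hpb)
    (hpt.symm.mul_right hab.coprime_mul_left)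
  have hcard : (p * t).primeFactors.card = t.primeFactors.card + 1 := by
    rw [hpt.primeFactors_mul, Finset.card_union_of_disjoint hpt.disjoint_primeFactors,
      hp.primeFactors, Finset.card_singleton, add_comm]
  rw [hcard, mul_right_comm p, mul_comm (p * b)]
  omega

end RealQuadratic

section ConsecutiveIntegers

theorem exists_squarefree_coprime_card_primeFactors_eq {B : ℕ} (hB : B ≠ 0) (n : ℕ) :
    ∃ a : ℕ, Squarefree a ∧ a.primeFactors.card = n ∧ a.Coprime B := by
  induction n with
  | zero => exact ⟨1, squarefree_one, by simp, Nat.coprime_one_left B⟩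
  | succ n ih =>
    obtain ⟨a, ha, hcard, haB⟩ := ih
    obtain ⟨p, hlt, hp⟩ := Nat.exists_infinite_primes (a * B + 1)
    have hpaB : p.Coprime (a * B) :=
      Nat.coprime_of_lt_prime (mul_ne_zero ha.ne_zero hB) hlt hp
    have hpa : p.Coprime a := hpaB.coprime_mul_right_right
    refine ⟨p * a, (Nat.squarefree_mul hpa).2 ⟨hp.prime.squarefree, ha⟩, ?_,
      hpaB.coprime_mul_left_right.mul_left haB⟩
    rw [hpa.primeFactors_mul, Finset.card_union_of_disjoint hpa.disjoint_primeFactors,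
      hp.primeFactors, Finset.card_singleton, hcard, add_comm]

theorem exists_seq_squarefree_pairwise_coprime {B : ℕ} (hB : B ≠ 0) (n : ℕ) :
    ∃ a : ℕ → ℕ, (∀ i, Squarefree (a i) ∧ (a i).primeFactors.card = n ∧ (a i).Coprime B) ∧
      Pairwise (Function.onFun Nat.Coprime a) := by
  have : Std.Symm Nat.Coprime := ⟨fun _ _ => Nat.Coprime.symm⟩
  refine exists_seq_of_forall_finset_exists'
    (fun a => Squarefree a ∧ a.primeFactors.card = n ∧ a.Coprime B) Nat.Coprime fun s hs => ?_
  obtain ⟨a, ha, hcard, hcop⟩ := exists_squarefree_coprime_card_primeFactors_eq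
    (mul_ne_zero hB (Finset.prod_ne_zero_iff.2 fun x hx => (hs x hx).1.ne_zero)) n
  exact ⟨a, ⟨ha, hcard, hcop.coprime_mul_right_right⟩, fun x hx =>
    (hcop.coprime_mul_left_right.coprime_dvd_right (Finset.dvd_prod_of_mem _ hx)).symm⟩

/-- The congruences `d + i ≡ a i` modulo `a i ^ 2` make the cofactor `≡ 1` modulo `a i`. -/
theorem exists_forall_add_eq_mul_coprime {a : ℕ → ℕ} (ha0 : ∀ i, a i ≠ 0)
    (ha : Pairwise (Function.onFun Nat.Coprime a)) (s : Finset ℕ) :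
    ∃ d, ∀ i ∈ s, ∃ b, d + i = a i * b ∧ (a i).Coprime b := by
  obtain ⟨d, hd⟩ := Nat.chineseRemainderOfFinset (fun i => a i + (a i ^ 2 * i - i))
    (fun i => a i ^ 2) s (fun i _ => pow_ne_zero 2 (ha0 i))
    (fun i _ j _ hij => (ha hij).pow 2 2)
  refine ⟨d, fun i hi => ?_⟩
  have hshift : a i + (a i ^ 2 * i - i) + i = a i + a i ^ 2 * i := by
    rw [add_assoc, Nat.sub_add_cancel]
    exact Nat.le_mul_of_pos_left i (pow_pos (Nat.pos_of_ne_zero (ha0 i)) 2)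
  have hmod : d + i ≡ a i [MOD a i ^ 2] := by
    simpa [Nat.ModEq, hshift] using (hd i hi).add_right i
  obtain ⟨b, hb⟩ : a i ∣ d + i := (hmod.dvd_iff (dvd_pow_self _ two_ne_zero)).2 dvd_rfl
  have hb1 : b ≡ 1 [MOD a i] := by
    refine Nat.ModEq.mul_left_cancel' (ha0 i) ?_
    rwa [← hb, mul_one, ← sq]
  exact ⟨b, hb, Nat.Coprime.symm (by rw [Nat.Coprime, hb1.gcd_eq, Nat.gcd_one_left])⟩

theorem coprime_add_of_dvd_add_of_coprime_factorial {a d i j k : ℕ} (hk : a.Coprime k.factorial)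
    (hai : a ∣ d + i) (hi : i ≤ k) (hj : j ≤ k) (hij : i ≠ j) : a.Coprime (d + j) := by
  refine Nat.coprime_of_dvd fun p hp hpa hpj => hij ?_
  have hkp : k < p := by
    by_contra! hpk
    exact Nat.not_coprime_of_dvd_of_dvd hp.one_lt hpa (hp.dvd_factorial.2 hpk) hk
  have hmod : i ≡ j [MOD p] := Nat.ModEq.add_left_cancel' d <|
    (Nat.modEq_zero_iff_dvd.2 (hpa.trans hai)).trans (Nat.modEq_zero_iff_dvd.2 hpj).symm
  exact hmod.eq_of_lt_of_lt (hi.trans_lt hkp) (hj.trans_lt hkp)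

theorem exists_consecutive_eq_squarefree_mul_coprime (k n : ℕ) :
    ∃ (d : ℕ) (a b : ℕ → ℕ), ∀ i ∈ Finset.Icc 1 k, d + i = a i * b i ∧ Squarefree (a i) ∧
      (a i).primeFactors.card = n ∧ (a i).Coprime (b i) ∧
      ∀ j ∈ Finset.Icc 1 k, i ≠ j → (a i).Coprime (d + j) := by
  obtain ⟨a, ha, hcop⟩ := exists_seq_squarefree_pairwise_coprime k.factorial_ne_zero n
  obtain ⟨d, hd⟩ := exists_forall_add_eq_mul_coprime (fun i => (ha i).1.ne_zero) hcop
    (Finset.Icc 1 k)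
  choose! b hb hab using hd
  exact ⟨d, a, b, fun i hi => ⟨hb i hi, (ha i).1, (ha i).2.1, hab i hi, fun j hj hij =>
    coprime_add_of_dvd_add_of_coprime_factorial (ha i).2.2 ⟨b i, hb i hi⟩
      (Finset.mem_Icc.1 hi).2 (Finset.mem_Icc.1 hj).2 hij⟩⟩

end ConsecutiveIntegers

theorem theorem5p3 (k : ℕ) (hk : 1 ≤ k) (M : ℝ) (hM : 0 < M) :
    ∃ d : ℤ,
      (∀ i ∈ Finset.Icc 1 k,
        0 < d + (i : ℤ) ∧ Module.finrank ℚ (realQuadField (d + (i : ℤ))) = 2) ∧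
      (∀ i ∈ Finset.Icc 1 k, ∀ j ∈ Finset.Icc 1 k, i ≠ j →
        realQuadField (d + (i : ℤ)) ≠ realQuadField (d + (j : ℤ))) ∧
      (∀ i ∈ Finset.Icc 1 k, M < (realQuadClassNumber (d + (i : ℤ)) : ℝ)) := by
  obtain ⟨n, hn⟩ := pow_unbounded_of_one_lt (8 * M) (one_lt_two (α := ℝ))
  obtain ⟨d, a, b, h⟩ := exists_consecutive_eq_squarefree_mul_coprime k (n + 1)
  choose hdi hsf hcard hab hcop using h
  have ha1 : ∀ i ∈ Finset.Icc 1 k, a i ≠ 1 := fun i hi h => by simpa [h] using hcard i hi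
  have hns : ∀ i ∈ Finset.Icc 1 k, ¬ IsSquare (d + i) := fun i hi =>
    hdi i hi ▸ not_isSquare_mul_of_squarefree_of_coprime (hsf i hi) (ha1 i hi) (hab i hi)
  refine ⟨d, fun i hi => ⟨?_, ?_⟩, fun i hi j hj hij => ?_, fun i hi => ?_⟩
  · linarith [(Finset.mem_Icc.1 hi).1]
  · exact_mod_cast finrank_realQuadField (hns i hi)
  · have hns' : ¬ IsSquare ((d + i) * (d + j)) := by
      rw [hdi i hi, mul_assoc]
      exact not_isSquare_mul_of_squarefree_of_coprime (hsf i hi) (ha1 i hi)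
        ((hab i hi).mul_right (hcop i hi j hj hij))
    exact_mod_cast realQuadField_ne (hns i hi) hns'
  · have hle := two_pow_card_primeFactors_le_eight_mul_realQuadClassNumber (hsf i hi) (ha1 i hi)
      (hab i hi)
    rw [hcard i hi, ← hdi i hi] at hle
    have hbound : (2 : ℝ) ^ (n + 1) ≤ 8 * realQuadClassNumber (d + i : ℕ) := by
      exact_mod_cast hle
    have hpow : (2 : ℝ) ^ n < 2 ^ (n + 1) := pow_lt_pow_right₀ one_lt_two n.lt_succ_self
    push_cast at hbound
    linarith
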